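/- Let $L$ be a frame, with implication $\to$, least element $0$ and greatest element $1$. An $L$-subset of a set $X$ is a map $X\to L$; for $A,B\in L^X$ put $\mathrm{sub}(A,B)=\bigwedge_{x\in X}A(x)\to B(x)$, and for $f:X\to Y$ put $f^{\rightarrow}(A)(y)=\bigvee_{f(x)=y}A(x)$. **$L$-orders.** An $L$-ordered set $(P,e)$ is a set with a map $e:P\times P\to L$ such that $e(x,x)=1$, $e(x,y)\wedge e(y,z)\le e(x,z)$, and $e(x,y)\wedge e(y,x)=1$ implies $x=y$. An element $x$ is the supremum $\sqcup A$ of $A\in L^P$ if $e(x,y)=\bigwedge_{z\in P}A(z)\to e(z,y)$ for all $y\in P$. An $L$-subset $D\in L^P$ is directed if $\bigvee_x D(x)=1$ and $D(x)\wedge D(y)\le\bigvee_z D(z)\wedge e(x,z)\wedge e(y,z)$ for all $x,y$; $P$ is an $L$-dcpo if every directed $L$-subset has a supremum. Let $\mathcal D^*_L(P)$ be the set of directed $L$-subsets of $P$ that have a supremum. Put $\Downarrow x(y)=\bigwedge_{D\in\mathcal D^*_L(P)}\big(e(x,\sqcup D)\to\bigvee_{d}D(d)\wedge e(y,d)\big)$.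 $P$ is continuous if for every $x\in P$ the $L$-subset $\Downarrow x$ is directed with supremum $x$; a continuous $L$-dcpo is a continuous $L$-ordered set that is an $L$-dcpo. A map $f:P\to Q$ is Scott continuous if for every $D\in\mathcal D^*_L(P)$ the supremum of $f^{\rightarrow}(D)$ exists and equals $f(\sqcup D)$. **$L$-topologies.** An $L$-topology on $X$ is a family $\mathcal O(X)\subseteq L^X$ (the open sets) closed under binary meets and arbitrary joins and containing all constant maps. A map $f:X\to Y$ is continuous if $B\circ f\in\mathcal O(X)$ for all $B\in\mathcal O(Y)$. A point of $\mathcal O(X)$ is a map $p:\mathcal O(X)\to L$ that preserves binary meets and arbitrary joins and sends each constant map to its value; $X$ is $L$-sober if $x\mapsto[x]$, $[x](A)=A(x)$, is a bijection from $X$ to the set of points. Every $L$-sober $X$ is $T_0$ (points that agree on all open sets are equal), and for $T_0$ $X$ the specialization $L$-order $e(x,y)=\bigwedge_{A\in\mathcal O(X)}A(x)\to A(y)$ makes $X$ an $L$-ordered set $\Omega_LX$. For an $L$-ordered set $P$, $\Sigma_LP$ is $P$ with the $L$-topology of Scott open sets, i.e. of those $A\in L^P$ with $A(x)\wedge e(x,y)\le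 A(y)$ for all $x,y$ and $A(\sqcup D)=\bigvee_xA(x)\wedge D(x)$ for every $D\in\mathcal D^*_L(P)$. **Universal constructions.** An $L$-sobrification of $X$ is an $L$-sober space $Y$ with a continuous map $j:X\to Y$ such that for every $L$-sober space $Z$ and continuous $f:X\to Z$ there is a unique continuous $\bar f:Y\to Z$ with $f=\bar f\circ j$. A directed completion of a continuous $L$-ordered set $P$ is a continuous $L$-dcpo $Q$ with a Scott continuous map $j:P\to Q$ such that for every continuous $L$-dcpo $M$ and Scott continuous $f:P\to M$ there is a unique Scott continuous $\bar f:Q\to M$ with $\bar f\circ j=f$. **Theorem.** Let $P$ and $Q$ be continuous $L$-ordered sets. 1. If $(Y,j)$ is an $L$-sobrification of $\Sigma_LP$, then $(\Omega_LY,j)$ is a directed completion of $P$. 2. For every map $j:P\to Q$, if $(Q,j)$ is a directed completion of $P$, then $(\Sigma_LQ,j)$ is an $L$-sobrification of $\Sigma_LP$. 3. For every map $j:P\to Q$, $(Q,j)$ is a directed completion of $P$ if and only if $(\Sigma_LQ,j)$ is an $L$-sobrification of $\Sigma_LP$. -/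

import Mathlib

universe u

/-! `L` is a frame throughout.  An `L`-subset of `X` is a map `X → L`; the pointwise order,
meets and joins of `L`-subsets are those of the function space. -/

section LSubsets

variable {L X Y : Type u} [Order.Frame L]

/-- The inclusion degree `sub(A, B) = ⋀ x, A x → B x` of `L`-subsets. -/
def inclDegree (A B : X → L) : L := ⨅ x, A x ⇨ B x

/-- The forward Zadeh extension `f^→(A)(y) = ⋁ {A x | f x = y}`. -/
def zadehImage (f : X → Y) (A : X → L) : Y → L := fun y => ⨆ x, ⨆ _ : f x = y, A x

end LSubsets

/-- An `L`-order on `P`. -/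
structure LOrder (L P : Type u) [Order.Frame L] where
  e : P → P → L
  refl : ∀ x, e x x = ⊤
  trans : ∀ x y z, e x y ⊓ e y z ≤ e x z
  antisymm : ∀ x y, e x y ⊓ e y x = ⊤ → x = y

/-- A (stratified) `L`-topology on `X`, given by its family of open `L`-subsets. -/
structure LTopology (L X : Type u) [Order.Frame L] where
  opens : Set (X → L)
  inf_mem : ∀ A ∈ opens, ∀ B ∈ opens, A ⊓ B ∈ opens
  sSup_mem : ∀ S ⊆ opens, sSup S ∈ opens
  const_mem : ∀ a : L, (fun _ => a) ∈ opens

namespace LOrder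

variable {L P Q : Type u} [Order.Frame L]

/-- The principal lower set `↓x`. -/
def lower (o : LOrder L P) (x : P) : P → L := fun y => o.e y x

/-- `x` is the supremum of the `L`-subset `A`: `e(x, y) = sub(A, ↓y)` for every `y`. -/
def IsSup (o : LOrder L P) (A : P → L) (x : P) : Prop :=
  ∀ y, o.e x y = inclDegree A (o.lower y)

/-- `A` is an upper set. -/
def IsUpper (o : LOrder L P) (A : P → L) : Prop :=
  ∀ x y, A x ⊓ o.e x y ≤ A y

/-- `D` is a directed `L`-subset (nonempty meaning that its join of values is `⊤`). -/
structure IsDirected (o : LOrder L P) (D : P → L) : Prop where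
  nonempty : ⨆ x, D x = ⊤
  directed : ∀ x y, D x ⊓ D y ≤ ⨆ z, D z ⊓ o.e x z ⊓ o.e y z

/-- `P` is an `L`-dcpo: every directed `L`-subset has a supremum. -/
def IsDcpo (o : LOrder L P) : Prop :=
  ∀ D : P → L, o.IsDirected D → ∃ x, o.IsSup D x

/-- The way-below `L`-subset of `x`, the meet being taken over all directed `L`-subsets `D` that
have a supremum `s`:  `⇓x(y) = ⋀_D e(x, ⊔D) → ⋁_d D(d) ∧ e(y, d)`. -/
def wayBelow (o : LOrder L P) (x : P) : P → L := fun y =>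
  ⨅ (D : P → L) (s : P) (_ : o.IsDirected D) (_ : o.IsSup D s),
    o.e x s ⇨ ⨆ d, D d ⊓ o.e y d

/-- `P` is a continuous `L`-ordered set: every `⇓x` is directed and has supremum `x`. -/
def IsContinuous (o : LOrder L P) : Prop :=
  ∀ x, o.IsDirected (o.wayBelow x) ∧ o.IsSup (o.wayBelow x) x

/-- `f` is Scott continuous: for every directed `D` that has a supremum `x`, the `L`-subset
`f^→(D)` has a supremum, namely `f x`. -/
def ScottContinuous (o : LOrder L P) (o' : LOrder L Q) (f : P → Q) : Prop :=
  ∀ (D : P → L) (x : P), o.IsDirected D → o.IsSup D x → o'.IsSup (zadehImage f D) (f x)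

/-- `A` is Scott open: an upper set with `A(⊔D) = ⋁ y, A y ∧ D y` for every directed `D` that
has a supremum. -/
structure IsScottOpen (o : LOrder L P) (A : P → L) : Prop where
  upper : o.IsUpper A
  sup_eq : ∀ (D : P → L) (x : P), o.IsDirected D → o.IsSup D x → A x = ⨆ y, A y ⊓ D y

/-- The Scott `L`-topology; `P` with this topology is the space `Σ_L P`. -/
def scott (o : LOrder L P) : LTopology L P where
  opens := {A | o.IsScottOpen A}
  inf_mem := by
    intro A hA B hB
    replace hA : o.IsScottOpen A := hA
    replace hB : o.IsScottOpen B := hB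
    refine ⟨fun x y => ?_, fun D s hD hs => le_antisymm ?_ ?_⟩
    · exact le_inf ((inf_le_inf_right _ inf_le_left).trans (hA.upper x y))
        ((inf_le_inf_right _ inf_le_right).trans (hB.upper x y))
    · rw [Pi.inf_apply, hA.sup_eq D s hD hs, hB.sup_eq D s hD hs, iSup_inf_iSup]
      refine iSup_le fun ⟨x, y⟩ => ?_
      have h1 : A x ⊓ D x ⊓ (B y ⊓ D y) ≤ A x ⊓ B y ⊓ ⨆ z, D z ⊓ o.e x z ⊓ o.e y z :=
        le_inf (inf_le_inf inf_le_left inf_le_left)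
          ((inf_le_inf inf_le_right inf_le_right).trans (hD.directed x y))
      refine h1.trans ?_
      rw [inf_iSup_eq]
      refine iSup_mono fun z => ?_
      refine le_inf (le_inf ?_ ?_) ?_
      · refine le_trans ?_ (hA.upper x z)
        exact inf_le_inf inf_le_left (inf_le_left.trans inf_le_right)
      · refine le_trans ?_ (hB.upper y z)
        exact inf_le_inf inf_le_right inf_le_right
      · exact inf_le_right.trans (inf_le_left.trans inf_le_left)
    · refine iSup_le fun y => le_inf ?_ ?_
      · rw [hA.sup_eq D s hD hs]
        exact (inf_le_inf_right _ inf_le_left).trans (le_iSup (fun y => A y ⊓ D y) y)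
      · rw [hB.sup_eq D s hD hs]
        exact (inf_le_inf_right _ inf_le_right).trans (le_iSup (fun y => B y ⊓ D y) y)
  sSup_mem := by
    intro S hS
    replace hS : ∀ A ∈ S, o.IsScottOpen A := hS
    refine ⟨fun x y => ?_, fun D s hD hs => ?_⟩
    · rw [sSup_apply, sSup_apply, iSup_inf_eq]
      exact iSup_mono fun A => (hS A.1 A.2).upper x y
    · simp only [sSup_apply, iSup_inf_eq]
      rw [iSup_comm]
      exact iSup_congr fun A => (hS A.1 A.2).sup_eq D s hD hs
  const_mem := by
    intro a
    refine ⟨fun x y => inf_le_left, fun D s hD _ => ?_⟩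
    rw [← inf_iSup_eq, hD.nonempty, inf_top_eq]

end LOrder

namespace LTopology

variable {L X Y : Type u} [Order.Frame L]

/-- `f` is continuous: preimages `B ∘ f` of open `L`-subsets are open. -/
def Continuous (τ : LTopology L X) (τ' : LTopology L Y) (f : X → Y) : Prop :=
  ∀ B ∈ τ'.opens, B ∘ f ∈ τ.opens

/-- The `T₀` axiom. -/
def IsT0 (τ : LTopology L X) : Prop :=
  ∀ x y, (∀ A ∈ τ.opens, A x = A y) → x = y

/-- The specialization `L`-order `e(x, y) = ⋀_A A x → A y` of a `T₀` space `X`; `X` with this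
order is `Ω_L X`. -/
def specialization (τ : LTopology L X) (h : τ.IsT0) : LOrder L X where
  e x y := ⨅ A ∈ τ.opens, A x ⇨ A y
  refl x := by simp
  trans x y z := by
    refine le_iInf₂ fun A hA => ?_
    exact (inf_le_inf (iInf₂_le A hA) (iInf₂_le A hA)).trans (himp_triangle _ _ _)
  antisymm x y hxy := by
    obtain ⟨h1, h2⟩ := inf_eq_top_iff.1 hxy
    simp only [iInf_eq_top, himp_eq_top_iff] at h1 h2
    exact h x y fun A hA => le_antisymm (h1 A hA) (h2 A hA)

/-- A point of `O(X)`: a map `O(X) → L` preserving binary meets, arbitrary joins and constants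
(that is, an `L`-frame homomorphism from `O(X)` to `L`). -/
@[ext]
structure Point (τ : LTopology L X) where
  toFun : τ.opens → L
  map_inf : ∀ A B : τ.opens, toFun ⟨A.1 ⊓ B.1, τ.inf_mem A.1 A.2 B.1 B.2⟩ = toFun A ⊓ toFun B
  map_sSup : ∀ S : Set τ.opens,
    toFun ⟨sSup (Subtype.val '' S), τ.sSup_mem _ (Subtype.coe_image_subset _ S)⟩ =
      ⨆ A ∈ S, toFun A
  map_const : ∀ a : L, toFun ⟨fun _ => a, τ.const_mem a⟩ = a

/-- The map `η_X : X → pt_L O(X)`, `x ↦ [x]` with `[x](A) = A x`. -/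
def eta (τ : LTopology L X) (x : X) : τ.Point where
  toFun A := A.1 x
  map_inf _ _ := rfl
  map_sSup S := by
    change sSup (Subtype.val '' S) x = ⨆ A ∈ S, A.1 x
    simp only [sSup_image, iSup_apply]
  map_const _ := rfl

/-- `X` is `L`-sober: `η_X` is a bijection. -/
def IsLSober (τ : LTopology L X) : Prop := Function.Bijective τ.eta

theorem IsLSober.isT0 {τ : LTopology L X} (h : τ.IsLSober) : τ.IsT0 := by
  intro x y hxy
  refine h.1 (Point.ext ?_)
  funext A
  exact hxy A.1 A.2

end LTopology

/-- `(Y, j)` is an `L`-sobrification of `X`. -/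
structure IsLSobrification {L X Y : Type u} [Order.Frame L]
    (τX : LTopology L X) (τY : LTopology L Y) (j : X → Y) : Prop where
  sober : τY.IsLSober
  continuous : τX.Continuous τY j
  universal : ∀ (Z : Type u) (τZ : LTopology L Z), τZ.IsLSober →
    ∀ f : X → Z, τX.Continuous τZ f → ∃! g : Y → Z, τY.Continuous τZ g ∧ f = g ∘ j

/-- `(Q, j)` is a directed completion of the continuous `L`-ordered set `P`. -/
structure IsDirectedCompletion {L P Q : Type u} [Order.Frame L]
    (oP : LOrder L P) (oQ : LOrder L Q) (j : P → Q) : Prop where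
  isContinuous : oQ.IsContinuous
  isDcpo : oQ.IsDcpo
  scottContinuous : oP.ScottContinuous oQ j
  universal : ∀ (M : Type u) (oM : LOrder L M), oM.IsContinuous → oM.IsDcpo →
    ∀ f : P → M, oP.ScottContinuous oM f → ∃! g : Q → M, oQ.ScottContinuous oM g ∧ g ∘ j = f

/-! Both universal properties reduce to one condition: `j` induces a bijection between open sets
(`IsQuasiHomeomorph`), with a sober target. A continuous map into a sober space extends uniquely
along such a `j`, since points of a sober space are homomorphisms on its open sets. Conversely, a
sobrification is compared with the spectrum of points; uniqueness makes it a retract of the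
spectrum, so it inherits the bijection.

Orders and topologies match as follows. The Scott space of a continuous `L`-dcpo is sober, and for
continuous targets Scott continuity is topological continuity. In the other direction, let `Y` be
sober and quasi-homeomorphic to the Scott space of a continuous `P`. The sets `x ↦ ⇓x(z)` lift to a
base of `Y`, whose values at `y` give a directed set, way below `y`, with supremum `y`. Hence the
specialization order is a continuous `L`-dcpo whose Scott topology is the given one.

A sobrification therefore yields a completion by testing only against Scott spaces. A completion is
compared with the spectrum, now seen as a continuous `L`-dcpo, by the same retract argument. -/

namespace LOrder

variable {L P Q : Type u} [Order.Frame L] {o : LOrder L P} {o' : LOrder L Q}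

/-! ### Suprema, the way-below relation and Scott open sets -/

theorem IsSup.le_iff {D : P → L} {s : P} (h : o.IsSup D s) {a : L} {y : P} :
    a ≤ o.e s y ↔ ∀ z, a ⊓ D z ≤ o.e z y := by
  rw [h y, inclDegree, le_iInf_iff]
  exact forall_congr' fun z => le_himp_iff

theorem IsSup.le_e {D : P → L} {s : P} (h : o.IsSup D s) (z : P) : D z ≤ o.e z s := by
  have := (h.le_iff (a := ⊤) (y := s)).1 (o.refl s).ge z
  rwa [top_inf_eq] at this

/-- The defining equality of a supremum, as two inequalities. -/
theorem isSup_of_le {D : P → L} {s : P} (h₁ : ∀ z, D z ≤ o.e z s)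
    (h₂ : ∀ (a : L) (y : P), (∀ z, a ⊓ D z ≤ o.e z y) → a ≤ o.e s y) : o.IsSup D s := by
  intro y
  refine le_antisymm (le_iInf fun z => le_himp_iff.2 ?_) (h₂ _ y fun z => ?_)
  · rw [inf_comm]
    exact (inf_le_inf_right _ (h₁ z)).trans (o.trans z s y)
  · exact le_himp_iff.1 (iInf_le _ z)

theorem IsSup.unique {D : P → L} {s t : P} (hs : o.IsSup D s) (ht : o.IsSup D t) : s = t := by
  refine o.antisymm s t (inf_eq_top_iff.2 ⟨?_, ?_⟩)
  · rw [hs t, ← ht t, o.refl]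
  · rw [ht s, ← hs s, o.refl]

theorem isDirected_lower (o : LOrder L P) (x : P) : o.IsDirected (o.lower x) where
  nonempty := top_le_iff.1 ((o.refl x).ge.trans (le_iSup (o.lower x) x))
  directed y z := by
    refine le_iSup_of_le x ?_
    simp [lower, o.refl]

theorem isSup_lower (o : LOrder L P) (x : P) : o.IsSup (o.lower x) x := by
  refine isSup_of_le (fun z => le_rfl) fun a y h => ?_
  simpa [lower, o.refl] using h x

theorem wayBelow_le_of_isSup (o : LOrder L P) (x y : P) {D : P → L} {s : P} (hD : o.IsDirected D)
    (hs : o.IsSup D s) : o.wayBelow x y ⊓ o.e x s ≤ ⨆ d, D d ⊓ o.e y d :=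
  le_himp_iff.1 <| iInf_le_of_le D <| iInf_le_of_le s <| iInf_le_of_le hD <| iInf_le _ hs

theorem le_wayBelow_iff {a : L} {x y : P} : a ≤ o.wayBelow x y ↔
    ∀ (D : P → L) (s : P), o.IsDirected D → o.IsSup D s →
      a ⊓ o.e x s ≤ ⨆ d, D d ⊓ o.e y d := by
  simp only [wayBelow, le_iInf_iff, le_himp_iff]

theorem wayBelow_le_e (o : LOrder L P) (x y : P) : o.wayBelow x y ≤ o.e y x := by
  have := o.wayBelow_le_of_isSup x y (o.isDirected_lower x) (o.isSup_lower x)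
  rw [o.refl, inf_top_eq] at this
  refine this.trans (iSup_le fun d => ?_)
  rw [inf_comm]
  exact o.trans y d x

theorem wayBelow_inf_e_le (o : LOrder L P) (x x' y : P) :
    o.wayBelow x y ⊓ o.e x x' ≤ o.wayBelow x' y := by
  refine le_wayBelow_iff.2 fun D s hD hs => ?_
  rw [inf_assoc]
  exact (inf_le_inf_left _ (o.trans x x' s)).trans (o.wayBelow_le_of_isSup x y hD hs)

theorem e_inf_wayBelow_le (o : LOrder L P) (x y y' : P) :
    o.e y' y ⊓ o.wayBelow x y ≤ o.wayBelow x y' := by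
  refine le_wayBelow_iff.2 fun D s hD hs => ?_
  rw [inf_assoc]
  refine (inf_le_inf_left _ (o.wayBelow_le_of_isSup x y hD hs)).trans ?_
  rw [inf_iSup_eq]
  refine iSup_mono fun d => le_inf (inf_le_right.trans inf_le_left) ?_
  exact (inf_le_inf_left _ inf_le_right).trans (o.trans y' y d)

/-- Interpolation in a continuous `L`-ordered set. -/
theorem IsContinuous.wayBelow_le_iSup (h : o.IsContinuous) (x y : P) :
    o.wayBelow x y ≤ ⨆ z, o.wayBelow x z ⊓ o.wayBelow z y := by
  -- The two-step way-below set is directed with supremum `x`, so it can be used to test `⇓x`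
  -- itself.
  set E : P → L := fun y => ⨆ z, o.wayBelow x z ⊓ o.wayBelow z y with hE
  have hdir : o.IsDirected E := by
    refine ⟨?_, fun a b => ?_⟩
    · rw [hE, iSup_comm]
      simp only [← inf_iSup_eq, (h _).1.nonempty, inf_top_eq]
    · simp only [hE, iSup_inf_iSup]
      refine iSup_le fun ⟨u, v⟩ => ?_
      have h1 : o.wayBelow x u ⊓ o.wayBelow u a ⊓ (o.wayBelow x v ⊓ o.wayBelow v b) ≤
          (o.wayBelow u a ⊓ o.wayBelow v b) ⊓ ⨆ w, o.wayBelow x w ⊓ o.e u w ⊓ o.e v w :=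
        le_inf (inf_le_inf inf_le_right inf_le_right)
          ((inf_le_inf inf_le_left inf_le_left).trans ((h x).1.directed u v))
      refine h1.trans ?_
      rw [inf_iSup_eq]
      refine iSup_le fun w => ?_
      have h2 : o.wayBelow u a ⊓ o.wayBelow v b ⊓ (o.wayBelow x w ⊓ o.e u w ⊓ o.e v w) ≤
          o.wayBelow x w ⊓ ⨆ c, o.wayBelow w c ⊓ o.e a c ⊓ o.e b c := by
        refine le_inf (inf_le_right.trans (inf_le_left.trans inf_le_left))
          (le_trans (le_inf ?_ ?_) ((h w).1.directed a b))
        · exact (inf_le_inf inf_le_left (inf_le_left.trans inf_le_right)).trans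
            (o.wayBelow_inf_e_le u w a)
        · exact (inf_le_inf inf_le_right inf_le_right).trans (o.wayBelow_inf_e_le v w b)
      refine h2.trans ?_
      rw [inf_iSup_eq]
      refine iSup_mono fun c => ?_
      rw [← inf_assoc, ← inf_assoc]
      exact inf_le_inf_right _ (inf_le_inf_right _
        (le_iSup (fun z => o.wayBelow x z ⊓ o.wayBelow z c) w))
  have hsup : o.IsSup E x := by
    refine isSup_of_le (fun z => iSup_le fun w => ?_) fun a y hy => ?_
    · rw [inf_comm]
      exact (inf_le_inf (o.wayBelow_le_e w z) (o.wayBelow_le_e x w)).trans (o.trans z w x)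
    · refine (h x).2.le_iff.2 fun z => (h z).2.le_iff.2 fun w => ?_
      rw [inf_assoc]
      exact (inf_le_inf_left _ (le_iSup (fun z => o.wayBelow x z ⊓ o.wayBelow z w) z)).trans (hy w)
  have := o.wayBelow_le_of_isSup x y hdir hsup
  rw [o.refl, inf_top_eq] at this
  refine this.trans (iSup_le fun d => ?_)
  rw [hE, iSup_inf_eq]
  refine iSup_mono fun z => ?_
  rw [inf_assoc, inf_comm (o.wayBelow z d)]
  exact inf_le_inf_left _ (o.e_inf_wayBelow_le z d y)

/-- Interpolate `y ≪ z ≪ s`: the intermediate `z` lies below some `d` in `D`, whence `y ≪ d`. -/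
theorem IsContinuous.isScottOpen_wayBelow (h : o.IsContinuous) (y : P) :
    o.IsScottOpen fun x => o.wayBelow x y := by
  refine ⟨fun x x' => o.wayBelow_inf_e_le x x' y, fun D s hD hs => le_antisymm ?_ ?_⟩
  · refine (h.wayBelow_le_iSup s y).trans (iSup_le fun z => ?_)
    have := o.wayBelow_le_of_isSup s z hD hs
    rw [o.refl, inf_top_eq] at this
    refine (inf_le_inf_right _ this).trans ?_
    rw [iSup_inf_eq]
    refine iSup_mono fun d => le_inf ?_ (inf_le_left.trans inf_le_left)
    rw [inf_comm]
    exact (inf_le_inf_left _ inf_le_right).trans (o.wayBelow_inf_e_le z d y)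
  · exact iSup_le fun d => (inf_le_inf_left _ (hs.le_e d)).trans (o.wayBelow_inf_e_le d s y)

/-- Openness tested on `⇓x`. This makes the sets `x ↦ ⇓x(y)` a base, with the constants `A y` as
weights. -/
theorem IsContinuous.scottOpen_eq (h : o.IsContinuous) {A : P → L} (hA : o.IsScottOpen A) (x : P) :
    A x = ⨆ y, A y ⊓ o.wayBelow x y :=
  hA.sup_eq _ _ (h x).1 (h x).2

/-- In a continuous `L`-ordered set the Scott open sets determine the `L`-order. -/
theorem IsContinuous.iInf_scottOpen (h : o.IsContinuous) (x y : P) :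
    ⨅ A ∈ o.scott.opens, A x ⇨ A y = o.e x y := by
  refine le_antisymm ((h x).2.le_iff.2 fun z => ?_) (le_iInf₂ fun A hA => le_himp_iff.2 ?_)
  · exact (le_himp_iff.1 (iInf₂_le _ (h.isScottOpen_wayBelow z))).trans (o.wayBelow_le_e y z)
  · rw [inf_comm]
    exact IsScottOpen.upper hA x y

theorem IsContinuous.scott_isT0 (h : o.IsContinuous) : o.scott.IsT0 := by
  refine fun x y hxy => o.antisymm x y ?_
  rw [← h.iInf_scottOpen, ← h.iInf_scottOpen, inf_eq_top_iff]
  simp only [iInf_eq_top, himp_eq_top_iff]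
  exact ⟨fun A hA => (hxy A hA).le, fun A hA => (hxy A hA).ge⟩

theorem IsContinuous.specialization_scott (h : o.IsContinuous) (h0 : o.scott.IsT0) :
    o.scott.specialization h0 = o := by
  have he : (o.scott.specialization h0).e = o.e := by
    funext x y
    exact h.iInf_scottOpen x y
  cases o
  simp only [LTopology.specialization] at he ⊢
  simp [he]

/-! ### Zadeh images and Scott continuity -/

theorem iSup_zadehImage_inf (f : P → Q) (D : P → L) (B : Q → L) :
    ⨆ y, B y ⊓ zadehImage f D y = ⨆ x, B (f x) ⊓ D x := by
  refine le_antisymm (iSup_le fun y => ?_) (iSup_le fun x => ?_)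
  · rw [zadehImage, inf_iSup₂_eq]
    refine iSup₂_le fun x hx => ?_
    subst hx
    exact le_iSup (fun x => B (f x) ⊓ D x) x
  · exact le_iSup_of_le (f x) (inf_le_inf_left _ (le_iSup₂_of_le x rfl le_rfl))

theorem le_zadehImage (f : P → Q) (D : P → L) (x : P) : D x ≤ zadehImage f D (f x) :=
  le_iSup₂_of_le x rfl le_rfl

theorem inf_zadehImage_le {f : P → Q} {D : P → L} {a : L} {B : Q → L}
    (h : ∀ x, a ⊓ D x ≤ B (f x)) (y : Q) : a ⊓ zadehImage f D y ≤ B y := by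
  rw [zadehImage, inf_iSup₂_eq]
  refine iSup₂_le fun x hx => ?_
  subst hx
  exact h x

theorem zadehImage_le {f : P → Q} {D : P → L} {B : Q → L}
    (h : ∀ x, D x ≤ B (f x)) (y : Q) : zadehImage f D y ≤ B y := by
  refine iSup₂_le fun x hx => ?_
  subst hx
  exact h x

theorem isSup_zadehImage {f : P → Q} {D : P → L} {s : Q} (h₁ : ∀ x, D x ≤ o'.e (f x) s)
    (h₂ : ∀ (a : L) (y : Q), (∀ x, a ⊓ D x ≤ o'.e (f x) y) → a ≤ o'.e s y) :
    o'.IsSup (zadehImage f D) s :=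
  isSup_of_le (zadehImage_le (B := fun z => o'.e z s) h₁) fun a y h =>
    h₂ a y fun x => (inf_le_inf_left _ (le_zadehImage f D x)).trans (h (f x))

theorem isDirected_zadehImage {f : P → Q} {D : P → L} (hne : ⨆ x, D x = ⊤)
    (hdir : ∀ x y, D x ⊓ D y ≤ ⨆ z, D z ⊓ o'.e (f x) (f z) ⊓ o'.e (f y) (f z)) :
    o'.IsDirected (zadehImage f D) := by
  refine ⟨top_le_iff.1 (hne.ge.trans (iSup_le fun x => ?_)), fun a b => ?_⟩
  · exact le_iSup_of_le (f x) (le_zadehImage f D x)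
  · refine inf_zadehImage_le
      (B := fun b => ⨆ z, zadehImage f D z ⊓ o'.e a z ⊓ o'.e b z) (fun y => ?_) b
    rw [inf_comm]
    refine inf_zadehImage_le
      (B := fun a => ⨆ z, zadehImage f D z ⊓ o'.e a z ⊓ o'.e (f y) z) (fun x => ?_) a
    rw [inf_comm]
    refine (hdir x y).trans (iSup_le fun z => le_iSup_of_le (f z) ?_)
    exact inf_le_inf_right _ (inf_le_inf_right _ (le_zadehImage f D z))

theorem ScottContinuous.e_le {f : P → Q} (hf : o.ScottContinuous o' f) (x y : P) :
    o.e x y ≤ o'.e (f x) (f y) :=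
  (le_zadehImage f (o.lower y) x).trans
    ((hf _ y (o.isDirected_lower y) (o.isSup_lower y)).le_e (f x))

theorem ScottContinuous.isDirected_zadehImage {f : P → Q} (hf : o.ScottContinuous o' f)
    {D : P → L} (hD : o.IsDirected D) : o'.IsDirected (zadehImage f D) :=
  LOrder.isDirected_zadehImage hD.nonempty fun x y => (hD.directed x y).trans <|
    iSup_mono fun z => inf_le_inf (inf_le_inf_left _ (hf.e_le x z)) (hf.e_le y z)

theorem ScottContinuous.continuous {f : P → Q} (hf : o.ScottContinuous o' f) :
    o.scott.Continuous o'.scott f := by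
  refine fun B hB => ⟨fun x y => ?_, fun D s hD hs => ?_⟩
  · exact (inf_le_inf_left _ (hf.e_le x y)).trans (IsScottOpen.upper hB (f x) (f y))
  · exact (hB.sup_eq _ _ (hf.isDirected_zadehImage hD) (hf D s hD hs)).trans
      (iSup_zadehImage_inf f D B)

/-- For the converse, approximate `f s` by elements `z ≪ f s`; openness of the preimage of `{z ≪ ·}`
puts `z` below some `f x` with `x` in `D`. -/
theorem scottContinuous_iff (h' : o'.IsContinuous) {f : P → Q} :
    o.ScottContinuous o' f ↔ o.scott.Continuous o'.scott f := by
  refine ⟨ScottContinuous.continuous, fun hf D s hD hs => isSup_zadehImage (fun x => ?_) ?_⟩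
  · refine (hs.le_e x).trans ?_
    rw [← h'.iInf_scottOpen]
    refine le_iInf₂ fun B hB => le_himp_iff.2 ?_
    rw [inf_comm]
    exact IsScottOpen.upper (hf B hB) x s
  · intro a y h
    refine (h' (f s)).2.le_iff.2 fun z => ?_
    have h1 := (hf _ (h'.isScottOpen_wayBelow z)).sup_eq D s hD hs
    simp only [Function.comp_apply] at h1
    rw [h1, inf_iSup_eq]
    refine iSup_le fun x => le_trans (le_inf ?_ ?_) (o'.trans z (f x) y)
    · exact (inf_le_right.trans inf_le_left).trans (o'.wayBelow_le_e (f x) z)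
    · exact (inf_le_inf_left _ inf_le_right).trans (h x)

end LOrder

/-! ### Spectrum, quasi-homeomorphisms and sobrification -/

namespace LTopology

variable {L X Y Z : Type u} [Order.Frame L] {τ : LTopology L X} {τY : LTopology L Y}
  {τZ : LTopology L Z}

theorem iSup_mem (τ : LTopology L X) {ι : Sort*} {A : ι → X → L} (h : ∀ i, A i ∈ τ.opens) :
    ⨆ i, A i ∈ τ.opens :=
  τ.sSup_mem _ (Set.range_subset_iff.2 h)

theorem weightedSup_mem (τ : LTopology L X) {ι : Sort*} (a : ι → L) {A : ι → X → L}
    (h : ∀ i, A i ∈ τ.opens) : (fun x => ⨆ i, a i ⊓ A i x) ∈ τ.opens := by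
  convert τ.iSup_mem fun i => τ.inf_mem _ (τ.const_mem (a i)) _ (h i) using 1
  funext x
  simp

theorem Continuous.comp {f : X → Y} {g : Y → Z} (hg : τY.Continuous τZ g)
    (hf : τ.Continuous τY f) : τ.Continuous τZ (g ∘ f) :=
  fun B hB => hf _ (hg B hB)

theorem Point.map_iSup (p : τ.Point) {ι : Sort*} (B : ι → τ.opens) :
    p.toFun ⟨⨆ i, (B i).1, τ.iSup_mem fun i => (B i).2⟩ = ⨆ i, p.toFun (B i) := by
  have h := p.map_sSup (Set.range B)
  rw [iSup_range] at h
  rw [← h]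
  congr 2
  rw [← Set.range_comp]
  rfl

/-- Weights are constant open sets, which points preserve; so a point is determined by its values on
a base. -/
theorem Point.map_weightedSup (p : τ.Point) {ι : Sort*} (a : ι → L) (B : ι → τ.opens)
    (A : τ.opens) (h : ∀ x, A.1 x = ⨆ i, a i ⊓ (B i).1 x) :
    p.toFun A = ⨆ i, a i ⊓ p.toFun (B i) := by
  have h1 := p.map_iSup fun i =>
    (⟨(fun _ => a i) ⊓ (B i).1, τ.inf_mem _ (τ.const_mem _) _ (B i).2⟩ : τ.opens)
  have h2 : ∀ i, p.toFun ⟨(fun _ => a i) ⊓ (B i).1, τ.inf_mem _ (τ.const_mem _) _ (B i).2⟩ =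
      a i ⊓ p.toFun (B i) := fun i =>
    (p.map_inf ⟨_, τ.const_mem (a i)⟩ (B i)).trans (by rw [p.map_const])
  simp only [h2] at h1
  rw [← h1]
  congr 1
  refine Subtype.ext (funext fun x => ?_)
  rw [h x]
  simp

/-- The space of points of `O(X)`, with the open `L`-subsets `p ↦ p A`. -/
def spectrum (τ : LTopology L X) : LTopology L τ.Point where
  opens := Set.range fun (A : τ.opens) (p : τ.Point) => p.toFun A
  inf_mem := by
    rintro _ ⟨A, rfl⟩ _ ⟨B, rfl⟩
    exact ⟨⟨A.1 ⊓ B.1, τ.inf_mem A.1 A.2 B.1 B.2⟩, funext fun p => p.map_inf A B⟩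
  sSup_mem := by
    intro S hS
    obtain ⟨T, rfl⟩ := Set.subset_range_iff_exists_image_eq.1 hS
    refine ⟨⟨sSup (Subtype.val '' T), τ.sSup_mem _ (Subtype.coe_image_subset _ T)⟩,
      funext fun p => (p.map_sSup T).trans ?_⟩
    simp only [sSup_image, iSup_apply]
  const_mem a := ⟨⟨_, τ.const_mem a⟩, funext fun p => p.map_const a⟩

/-- `j` induces a bijection between the families of open `L`-subsets. -/
structure IsQuasiHomeomorph (τ : LTopology L X) (τY : LTopology L Y) (j : X → Y) : Prop where
  continuous : τ.Continuous τY j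
  ext : ∀ A ∈ τY.opens, ∀ B ∈ τY.opens, A ∘ j = B ∘ j → A = B
  exists_lift : ∀ A ∈ τ.opens, ∃ B ∈ τY.opens, B ∘ j = A

theorem spectrum_isLSober (τ : LTopology L X) : τ.spectrum.IsLSober := by
  refine ⟨fun p q h => Point.ext (funext fun A => ?_), fun p => ?_⟩
  · exact congrFun (congrArg Point.toFun h) ⟨_, A, rfl⟩
  · let q : τ.Point :=
      { toFun := fun A => p.toFun ⟨_, A, rfl⟩
        map_inf := fun A B => by
          rw [← p.map_inf]
          congr 2
          exact funext fun r => r.map_inf A B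
        map_sSup := fun S => by
          have h := p.map_sSup ((fun A => ⟨_, A, rfl⟩) '' S)
          rw [iSup_image] at h
          rw [← h]
          congr 2
          funext r
          refine (r.map_sSup S).trans ?_
          rw [Set.image_image, sSup_image]
          simp only [iSup_apply]
        map_const := fun a =>
          (congrArg p.toFun (Subtype.ext (funext fun r => r.map_const a))).trans (p.map_const a) }
    refine ⟨q, Point.ext (funext ?_)⟩
    rintro ⟨_, A, rfl⟩
    rfl

theorem isQuasiHomeomorph_eta (τ : LTopology L X) : τ.IsQuasiHomeomorph τ.spectrum τ.eta where
  continuous := by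
    rintro _ ⟨A, rfl⟩
    exact A.2
  ext := by
    rintro _ ⟨A, rfl⟩ _ ⟨B, rfl⟩ h
    have : A = B := Subtype.ext h
    rw [this]
  exists_lift A hA := ⟨_, ⟨⟨A, hA⟩, rfl⟩, rfl⟩

/-- Open sets of `Y` embed into those of `Z` by composition with `h`, so only the composite on `Y`
needs to be the identity. -/
theorem IsQuasiHomeomorph.of_retract {j : X → Y} {k : X → Z} (hk : τ.IsQuasiHomeomorph τZ k)
    {g : Y → Z} {h : Z → Y} (hg : τY.Continuous τZ g) (hh : τZ.Continuous τY h)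
    (hgj : g ∘ j = k) (hhk : h ∘ k = j) (hhg : h ∘ g = id) : τ.IsQuasiHomeomorph τY j where
  continuous := hhk ▸ hh.comp hk.continuous
  ext A hA B hB hAB := by
    have h1 : A ∘ h = B ∘ h := hk.ext _ (hh A hA) _ (hh B hB) (by
      rw [Function.comp_assoc, Function.comp_assoc, hhk, hAB])
    have h2 := congrArg (· ∘ g) h1
    simpa only [Function.comp_assoc, hhg, Function.comp_id] using h2
  exists_lift A hA := by
    obtain ⟨B, hB, rfl⟩ := hk.exists_lift A hA
    exact ⟨B ∘ g, hg B hB, by rw [Function.comp_assoc, hgj]⟩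

theorem continuous_ext_of_comp_eq (hT : τZ.IsT0) {j : X → Y} (hj : τ.IsQuasiHomeomorph τY j)
    {g g' : Y → Z} (hg : τY.Continuous τZ g) (hg' : τY.Continuous τZ g')
    (h : g ∘ j = g' ∘ j) : g = g' := by
  refine funext fun y => hT _ _ fun B hB => ?_
  refine congrFun (hj.ext _ (hg B hB) _ (hg' B hB) ?_) y
  rw [Function.comp_assoc, Function.comp_assoc, h]

theorem IsQuasiHomeomorph.exists_extension {j : X → Y} (hj : τ.IsQuasiHomeomorph τY j)
    (hZ : τZ.IsLSober) {f : X → Z} (hf : τ.Continuous τZ f) :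
    ∃ g : Y → Z, τY.Continuous τZ g ∧ f = g ∘ j := by
  choose l hl hlj using fun B : τZ.opens => hj.exists_lift _ (hf B.1 B.2)
  -- Lifts along `j` are unique, so lifting commutes with the frame operations and evaluation at `y`
  -- is a point of `Z`.
  have key : ∀ B : τZ.opens, ∀ A ∈ τY.opens, A ∘ j = B.1 ∘ f → l B = A := fun B A hA h =>
    hj.ext _ (hl B) _ hA ((hlj B).trans h.symm)
  let p : Y → τZ.Point := fun y =>
    { toFun := fun B => l B y
      map_inf := fun A B => by
        rw [key _ (l A ⊓ l B) (τY.inf_mem _ (hl A) _ (hl B))]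
        · rfl
        · calc (l A ⊓ l B) ∘ j = (l A ∘ j) ⊓ (l B ∘ j) := rfl
            _ = _ := by rw [hlj, hlj]; rfl
      map_sSup := fun S => by
        rw [key _ (⨆ A : S, l A) (τY.iSup_mem fun A => hl A)]
        · rw [iSup_apply, iSup_subtype']
        · funext x
          have h : ∀ A : τZ.opens, l A (j x) = A.1 (f x) := fun A => congrFun (hlj A) x
          simp only [Function.comp_apply, iSup_apply, h, sSup_image, iSup_subtype']
      map_const := fun a => by
        rw [key _ _ (τY.const_mem a) rfl] }
  choose g hg using fun y => hZ.2 (p y)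
  have hgl : ∀ B : τZ.opens, B.1 ∘ g = l B := fun B =>
    funext fun y => congrFun (congrArg Point.toFun (hg y)) B
  refine ⟨g, fun B hB => ?_, funext fun x => hZ.isT0 _ _ fun B hB => ?_⟩
  · exact (hgl ⟨B, hB⟩) ▸ hl ⟨B, hB⟩
  · exact (congrFun (hlj ⟨B, hB⟩) x).symm.trans (congrFun (hgl ⟨B, hB⟩) (j x)).symm

theorem IsQuasiHomeomorph.isLSobrification {j : X → Y} (hj : τ.IsQuasiHomeomorph τY j)
    (hY : τY.IsLSober) : IsLSobrification τ τY j where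
  sober := hY
  continuous := hj.continuous
  universal Z τZ hZ f hf := by
    obtain ⟨g, hg, hgf⟩ := hj.exists_extension hZ hf
    refine ⟨g, ⟨hg, hgf⟩, fun g' ⟨hg', hgf'⟩ => ?_⟩
    exact continuous_ext_of_comp_eq hZ.isT0 hj hg' hg (hgf'.symm.trans hgf)

/-- The composite `Y → spectrum → Y` fixes `j`, so uniqueness makes it the identity. -/
theorem _root_.IsLSobrification.isQuasiHomeomorph {j : X → Y} (h : IsLSobrification τ τY j) :
    τ.IsQuasiHomeomorph τY j := by
  have hη := τ.isQuasiHomeomorph_eta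
  obtain ⟨g, ⟨hg, hgj⟩, -⟩ := h.universal _ _ τ.spectrum_isLSober _ hη.continuous
  obtain ⟨k, hk, hkη⟩ := hη.exists_extension h.sober h.continuous
  refine hη.of_retract hg hk hgj.symm hkη.symm ?_
  refine (h.universal _ _ h.sober _ h.continuous).unique ⟨hk.comp hg, ?_⟩ ⟨fun B hB => hB, rfl⟩
  rw [Function.comp_assoc, ← hgj, hkη]

/-! ### Specialization order of a sober space -/

theorem specialization_e_le (h : τ.IsT0) {A : X → L} (hA : A ∈ τ.opens) (x y : X) :
    A x ⊓ (τ.specialization h).e x y ≤ A y := by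
  rw [inf_comm]
  exact le_himp_iff.1 (iInf₂_le A hA)

theorem le_specialization_e_iff (h : τ.IsT0) {a : L} {x y : X} :
    a ≤ (τ.specialization h).e x y ↔ ∀ A ∈ τ.opens, a ⊓ A x ≤ A y := by
  simp only [specialization, le_iInf_iff, le_himp_iff]

/-- In an `L`-sober space, every directed `L`-subset converges to a supremum. -/
theorem IsLSober.exists_isSup (h : τ.IsLSober) {D : X → L}
    (hD : (τ.specialization h.isT0).IsDirected D) :
    ∃ s, (τ.specialization h.isT0).IsSup D s ∧ ∀ A ∈ τ.opens, A s = ⨆ x, A x ⊓ D x := by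
  -- The degree to which `D` meets `A`; directedness gives preservation of meets, and sobriety turns
  -- this point into the limit `s`.
  let p : τ.Point :=
    { toFun := fun A => ⨆ x, A.1 x ⊓ D x
      map_inf := fun A B => by
        refine le_antisymm (le_inf ?_ ?_) ?_
        · exact iSup_mono fun x => inf_le_inf_right _ inf_le_left
        · exact iSup_mono fun x => inf_le_inf_right _ inf_le_right
        · rw [iSup_inf_iSup]
          refine iSup_le fun ⟨x, y⟩ => ?_
          have h1 : A.1 x ⊓ D x ⊓ (B.1 y ⊓ D y) ≤ A.1 x ⊓ B.1 y ⊓ _ :=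
            le_inf (inf_le_inf inf_le_left inf_le_left)
              ((inf_le_inf inf_le_right inf_le_right).trans (hD.directed x y))
          refine h1.trans ?_
          rw [inf_iSup_eq]
          refine iSup_mono fun z => le_inf (le_inf ?_ ?_) ?_
          · exact (inf_le_inf inf_le_left (inf_le_left.trans inf_le_right)).trans
              (specialization_e_le h.isT0 A.2 x z)
          · exact (inf_le_inf inf_le_right inf_le_right).trans
              (specialization_e_le h.isT0 B.2 y z)
          · exact inf_le_right.trans (inf_le_left.trans inf_le_left)
      map_sSup := fun S => by
        simp only [sSup_image, iSup_apply, iSup_inf_eq]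
        rw [iSup_comm]
        exact iSup_congr fun A => iSup_comm
      map_const := fun a => by
        rw [← inf_iSup_eq, hD.nonempty, inf_top_eq] }
  obtain ⟨s, hs⟩ := h.2 p
  have hA : ∀ A ∈ τ.opens, A s = ⨆ x, A x ⊓ D x := fun A hA =>
    congrFun (congrArg Point.toFun hs) ⟨A, hA⟩
  refine ⟨s, LOrder.isSup_of_le (fun z => ?_) fun a y hy => ?_, hA⟩
  · refine (le_specialization_e_iff h.isT0).2 fun A hA' => ?_
    rw [hA A hA', inf_comm]
    exact le_iSup (fun x => A x ⊓ D x) z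
  · refine (le_specialization_e_iff h.isT0).2 fun A hA' => ?_
    rw [hA A hA', inf_iSup_eq]
    refine iSup_le fun z => ?_
    rw [inf_left_comm]
    exact (inf_le_inf_left _ (hy z)).trans (specialization_e_le h.isT0 hA' z y)

theorem IsLSober.isDcpo (h : τ.IsLSober) : (τ.specialization h.isT0).IsDcpo := fun _ hD =>
  let ⟨s, hs, _⟩ := h.exists_isSup hD
  ⟨s, hs⟩

theorem IsLSober.isScottOpen (h : τ.IsLSober) {A : X → L} (hA : A ∈ τ.opens) :
    (τ.specialization h.isT0).IsScottOpen A := by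
  refine ⟨specialization_e_le h.isT0 hA, fun D s hD hs => ?_⟩
  obtain ⟨t, ht, htA⟩ := h.exists_isSup hD
  rw [hs.unique ht, htA A hA]

end LTopology

/-! ### Sobriety of Scott spaces and bases from continuity -/

namespace LOrder

variable {L P Q Y : Type u} [Order.Frame L] {o : LOrder L P} {τ : LTopology L Y}

theorem IsContinuous.isLSober_scott (h : o.IsContinuous) (hd : o.IsDcpo) : o.scott.IsLSober := by
  refine ⟨fun x y hxy => h.scott_isT0 x y fun A hA =>
    congrFun (congrArg LTopology.Point.toFun hxy) ⟨A, hA⟩, fun p => ?_⟩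
  let U : P → o.scott.opens := fun y => ⟨_, h.isScottOpen_wayBelow y⟩
  have hp : ∀ A : o.scott.opens, p.toFun A = ⨆ y, A.1 y ⊓ p.toFun (U y) := fun A =>
    p.map_weightedSup _ U A (h.scottOpen_eq A.2)
  -- `p.toFun (U y)` is the degree to which `y` is way below the point sought, so its supremum
  -- should represent `p`.
  have hD : o.IsDirected fun y => p.toFun (U y) := by
    refine ⟨?_, fun x y => ?_⟩
    · have := hp ⟨_, o.scott.const_mem ⊤⟩
      rw [p.map_const] at this
      simpa using this.symm
    · rw [← p.map_inf, hp]
      refine iSup_mono fun z => le_inf (le_inf inf_le_right ?_) ?_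
      · exact (inf_le_left.trans inf_le_left).trans (o.wayBelow_le_e z x)
      · exact (inf_le_left.trans inf_le_right).trans (o.wayBelow_le_e z y)
  obtain ⟨s, hs⟩ := hd _ hD
  refine ⟨s, LTopology.Point.ext (funext fun A => ?_)⟩
  exact (A.2.sup_eq _ s hD hs).trans (hp A).symm

/-- Testing `⇓x` against `D` shows that it lies in the lower closure of `D`, so directedness and
supremum pass from `D` to `⇓x`. -/
theorem isContinuous_of_le_wayBelow
    (h : ∀ x, ∃ D : P → L, o.IsDirected D ∧ o.IsSup D x ∧ ∀ y, D y ≤ o.wayBelow x y) :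
    o.IsContinuous := by
  intro x
  obtain ⟨D, hD, hs, hle⟩ := h x
  have hwb : ∀ y, o.wayBelow x y ≤ ⨆ d, D d ⊓ o.e y d := fun y => by
    simpa [o.refl] using o.wayBelow_le_of_isSup x y hD hs
  refine ⟨⟨top_le_iff.1 (hD.nonempty.ge.trans (iSup_mono hle)), fun a b => ?_⟩,
    isSup_of_le (o.wayBelow_le_e x) fun a y hy =>
      hs.le_iff.2 fun z => (inf_le_inf_left _ (hle z)).trans (hy z)⟩
  refine (inf_le_inf (hwb a) (hwb b)).trans ?_
  rw [iSup_inf_iSup]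
  refine iSup_le fun ⟨u, v⟩ => ?_
  have h1 : D u ⊓ o.e a u ⊓ (D v ⊓ o.e b v) ≤
      (o.e a u ⊓ o.e b v) ⊓ ⨆ c, D c ⊓ o.e u c ⊓ o.e v c :=
    le_inf (inf_le_inf inf_le_right inf_le_right)
      ((inf_le_inf inf_le_left inf_le_left).trans (hD.directed u v))
  refine h1.trans ?_
  rw [inf_iSup_eq]
  refine iSup_mono fun c => le_inf (le_inf ?_ ?_) ?_
  · exact (inf_le_right.trans (inf_le_left.trans inf_le_left)).trans (hle c)
  · exact (inf_le_inf inf_le_left (inf_le_left.trans inf_le_right)).trans (o.trans a u c)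
  · exact (inf_le_inf inf_le_right inf_le_right).trans (o.trans b v c)

/-- A quasi-homeomorphism from `Σ_L P` to `Y` provides open sets `U z` on `Y`, extending
`x ↦ ⇓x(z)`, which form a base in the sense that `B = ⋁ z, B (j z) ∧ U z` for every open `B`. -/
theorem IsContinuous.exists_base (h : o.IsContinuous) {j : P → Y}
    (hj : o.scott.IsQuasiHomeomorph τ j) :
    ∃ U : P → Y → L, (∀ z, U z ∈ τ.opens) ∧
      ∀ B ∈ τ.opens, ∀ y, B y = ⨆ z, B (j z) ⊓ U z y := by
  choose U hU hUj using fun z => hj.exists_lift _ (h.isScottOpen_wayBelow z)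
  refine ⟨U, hU, fun B hB y => ?_⟩
  refine congrFun (hj.ext B hB _ (τ.weightedSup_mem (fun z => B (j z)) hU) (funext fun x => ?_)) y
  have hx : ∀ z, U z (j x) = o.wayBelow x z := fun z => congrFun (hUj z) x
  simp only [Function.comp_apply, hx]
  exact h.scottOpen_eq (hj.continuous B hB) x

end LOrder

/-! ### From a base to a continuous specialization order -/

namespace LTopology

variable {L P Y : Type u} [Order.Frame L] {o : LOrder L P} {τ : LTopology L Y} {j : P → Y}
  {U : P → Y → L}

theorem base_le_specialization (h : τ.IsT0)
    (hB : ∀ B ∈ τ.opens, ∀ y, B y = ⨆ z, B (j z) ⊓ U z y) (z : P) (y : Y) :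
    U z y ≤ (τ.specialization h).e (j z) y := by
  refine (le_specialization_e_iff h).2 fun B hB' => ?_
  rw [inf_comm, hB B hB' y]
  exact le_iSup (fun z => B (j z) ⊓ U z y) z

theorem isDirected_base (h : τ.IsT0) (hU : ∀ z, U z ∈ τ.opens)
    (hB : ∀ B ∈ τ.opens, ∀ y, B y = ⨆ z, B (j z) ⊓ U z y) (y : Y) :
    (τ.specialization h).IsDirected (zadehImage j fun z => U z y) := by
  refine LOrder.isDirected_zadehImage ?_ fun a b => ?_
  · simpa using (hB _ (τ.const_mem ⊤) y).symm
  · refine (hB _ (τ.inf_mem _ (hU a) _ (hU b)) y).le.trans (iSup_mono fun z => ?_)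
    refine le_inf (le_inf inf_le_right ?_) ?_
    · exact (inf_le_left.trans inf_le_left).trans (base_le_specialization h hB a (j z))
    · exact (inf_le_left.trans inf_le_right).trans (base_le_specialization h hB b (j z))

theorem isSup_base (h : τ.IsT0) (hB : ∀ B ∈ τ.opens, ∀ y, B y = ⨆ z, B (j z) ⊓ U z y) (y : Y) :
    (τ.specialization h).IsSup (zadehImage j fun z => U z y) y := by
  refine LOrder.isSup_zadehImage (fun z => base_le_specialization h hB z y) fun a y' hy' => ?_
  refine (le_specialization_e_iff h).2 fun B hB' => ?_
  rw [hB B hB' y, inf_iSup_eq]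
  refine iSup_le fun z => ?_
  rw [inf_left_comm]
  exact (inf_le_inf_left _ (hy' z)).trans (specialization_e_le h hB' (j z) y')

/-- Sobriety makes `U z` Scott open, so if `U z` holds at the supremum of `D` it holds at some `d`,
and `U z` lies above `j z`. -/
theorem IsLSober.base_le_wayBelow (h : τ.IsLSober) (hU : ∀ z, U z ∈ τ.opens)
    (hB : ∀ B ∈ τ.opens, ∀ y, B y = ⨆ z, B (j z) ⊓ U z y) (z : P) (y : Y) :
    U z y ≤ (τ.specialization h.isT0).wayBelow y (j z) := by
  refine LOrder.le_wayBelow_iff.2 fun D s hD hs => ?_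
  refine (specialization_e_le h.isT0 (hU z) y s).trans ?_
  rw [(h.isScottOpen (hU z)).sup_eq D s hD hs]
  refine iSup_mono fun d => ?_
  rw [inf_comm]
  exact inf_le_inf_left _ (base_le_specialization h.isT0 hB z d)

theorem IsLSober.isContinuous (h : τ.IsLSober) (ho : o.IsContinuous)
    (hj : o.scott.IsQuasiHomeomorph τ j) : (τ.specialization h.isT0).IsContinuous := by
  obtain ⟨U, hU, hB⟩ := ho.exists_base hj
  exact LOrder.isContinuous_of_le_wayBelow fun y =>
    ⟨_, isDirected_base h.isT0 hU hB y, isSup_base h.isT0 hB y,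
      LOrder.zadehImage_le fun z => h.base_le_wayBelow hU hB z y⟩

/-- The topology of a sober space quasi-homeomorphic to `Σ_L P` is the Scott topology of its
specialization order. -/
theorem IsLSober.scott_specialization (h : τ.IsLSober) (ho : o.IsContinuous)
    (hj : o.scott.IsQuasiHomeomorph τ j) : (τ.specialization h.isT0).scott = τ := by
  obtain ⟨U, hU, hB⟩ := ho.exists_base hj
  have hopens : (τ.specialization h.isT0).scott.opens = τ.opens := by
    refine Set.Subset.antisymm (fun A hA => ?_) fun A hA => h.isScottOpen hA
    -- Scott openness on the directed base set at `y` writes `A` as a weighted join of open sets of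
    -- `τ`.
    have hA' : A = fun y => ⨆ z, A (j z) ⊓ U z y := funext fun y =>
      (LOrder.IsScottOpen.sup_eq hA _ y (isDirected_base h.isT0 hU hB y)
        (isSup_base h.isT0 hB y)).trans (LOrder.iSup_zadehImage_inf _ _ A)
    rw [hA']
    exact τ.weightedSup_mem _ hU
  generalize (τ.specialization h.isT0).scott = σ at hopens
  cases σ
  cases τ
  cases hopens
  rfl

end LTopology

/-! ### Sobrifications versus directed completions -/

theorem IsLSobrification.isDirectedCompletion {L P Y : Type u} [Order.Frame L] {o : LOrder L P}
    (ho : o.IsContinuous) {τ : LTopology L Y} {j : P → Y} (h : IsLSobrification o.scott τ j) :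
    IsDirectedCompletion o (τ.specialization h.sober.isT0) j := by
  have hj := h.isQuasiHomeomorph
  have hc := h.sober.isContinuous ho hj
  have hτ := h.sober.scott_specialization ho hj
  refine ⟨hc, h.sober.isDcpo, ?_, fun M oM hM hMd f hf => ?_⟩
  · rw [LOrder.scottContinuous_iff hc, hτ]
    exact h.continuous
  · simp only [LOrder.scottContinuous_iff hM, hτ] at hf ⊢
    simpa only [eq_comm] using h.universal M oM.scott (hM.isLSober_scott hMd) f hf

theorem IsDirectedCompletion.isLSobrification {L P Q : Type u} [Order.Frame L] {oP : LOrder L P}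
    {oQ : LOrder L Q} (hP : oP.IsContinuous) {j : P → Q} (h : IsDirectedCompletion oP oQ j) :
    IsLSobrification oP.scott oQ.scott j := by
  have hsob := h.isContinuous.isLSober_scott h.isDcpo
  have hη := oP.scott.isQuasiHomeomorph_eta
  have hs := oP.scott.spectrum_isLSober
  have hY := (hη.isLSobrification hs).isDirectedCompletion hP
  obtain ⟨g, ⟨hg, hgj⟩, -⟩ := h.universal _ _ hY.isContinuous hY.isDcpo _ hY.scottContinuous
  obtain ⟨k, hk, hkη⟩ := hη.exists_extension hsob h.scottContinuous.continuous
  have hg' : oQ.scott.Continuous oP.scott.spectrum g := by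
    have := hg.continuous
    rwa [hs.scott_specialization hP hη] at this
  refine (hη.of_retract hg' hk hgj hkη.symm ?_).isLSobrification hsob
  -- Uniqueness with target `Q` itself forces `k ∘ g = id`.
  refine (h.universal _ oQ h.isContinuous h.isDcpo _ h.scottContinuous).unique
    ⟨?_, ?_⟩ ⟨?_, rfl⟩
  · rw [LOrder.scottContinuous_iff h.isContinuous]
    exact hk.comp hg'
  · rw [Function.comp_assoc, hgj, ← hkη]
  · rw [LOrder.scottContinuous_iff h.isContinuous]
    exact fun B hB => hB

theorem mainTheorem4 {L P Q : Type u} [Order.Frame L]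
    (oP : LOrder L P) (oQ : LOrder L Q) (hP : oP.IsContinuous) (hQ : oQ.IsContinuous) :
    (∀ (Y : Type u) (τ : LTopology L Y) (j : P → Y) (h : IsLSobrification oP.scott τ j),
      IsDirectedCompletion oP (τ.specialization h.sober.isT0) j) ∧
    (∀ j : P → Q, IsDirectedCompletion oP oQ j → IsLSobrification oP.scott oQ.scott j) ∧
    (∀ j : P → Q, IsDirectedCompletion oP oQ j ↔ IsLSobrification oP.scott oQ.scott j) := by
  refine ⟨fun Y τ j h => h.isDirectedCompletion hP, fun j h => h.isLSobrification hP,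
    fun j => ⟨fun h => h.isLSobrification hP, fun h => ?_⟩⟩
  -- This gives a completion for the specialization order of the Scott space of `Q`, which is `oQ`
  -- because `Q` is continuous.
  have := h.isDirectedCompletion hP
  rwa [hQ.specialization_scott] at this
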